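/- For $\alpha>-1$ let $w_\alpha(x)=x^\alpha e^{-x}$ and $\|f\|_{w_\alpha}=\left(\int_0^\infty |f(x)|^2 w_\alpha(x)\,dx\right)^{1/2}$. For $n\in\mathbb N$ let $\mathcal P_n$ be the set of real polynomials of degree at most $n$, and let $$c_n(\alpha)=\sup_{p\in\mathcal P_n,\ p\neq 0}\frac{\|p'\|_{w_\alpha}}{\|p\|_{w_\alpha}}$$ be the best constant in the Markov inequality $\|p'\|_{w_\alpha}\le c_n(\alpha)\|p\|_{w_\alpha}$, $p\in\mathcal P_n$. Then, for every $k\in\{3,4,5,6\}$, every integer $n\ge k$ and every real $\alpha>-1$, the constant $c_n(\alpha)$ is finite and $$\underline{c}_{n,k}(\alpha)\le c_n(\alpha)\le\overline{c}_{n,k}(\alpha),$$ where $\underline{c}_{n,k}(\alpha)$ and $\overline{c}_{n,k}(\alpha)$ are the positive numbers whose squares are $$\underline{c}_{n,3}^2(\alpha)=\frac{2n\left(n+\frac{3(\alpha+1)}{8}\right)}{(\alpha+1)(\alpha+5)},\qquad \overline{c}_{n,3}^{2}(\alpha)=\frac{(n+1)\left(n+\frac{2(\alpha+1)}{5}\right)}{(\alpha+1)\left[(\alpha+3)(\alpha+5)\right]^{1/3}},$$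 $$\underline{c}_{n,4}^2(\alpha)=\frac{(5\alpha+17)\,n\left(n+\frac{8(\alpha+1)}{25}\right)}{2(\alpha+1)(\alpha+3)(\alpha+7)},\qquad \overline{c}_{n,4}^{2}(\alpha)=\frac{(5\alpha+17)^{1/4}(n+1)\left(n+\frac{3(\alpha+1)}{7}\right)}{(\alpha+1)(\alpha+3)^{1/2}\left[2(\alpha+5)(\alpha+7)\right]^{1/4}},$$ $$\underline{c}_{n,5}^2(\alpha)=\frac{2(7\alpha+31)\,n\left(n+\frac{25(\alpha+1)}{84}\right)}{(\alpha+1)(\alpha+9)(5\alpha+17)},\qquad \overline{c}_{n,5}^{2}(\alpha)=\frac{(7\alpha+31)^{1/5}(n+1)\left(n+\frac{4(\alpha+1)}{9}\right)}{(\alpha+1)(\alpha+3)^{2/5}\left[(\alpha+5)(\alpha+7)(\alpha+9)\right]^{1/5}},$$ $$\underline{c}_{n,6}^2(\alpha)=\frac{\left(21\alpha^3+299\alpha^2+1391\alpha+2073\right)n\left(n+\frac{2(\alpha+1)}{7}\right)}{(\alpha+1)(\alpha+3)(\alpha+5)(\alpha+11)(7\alpha+31)},$$ $$\overline{c}_{n,6}^{2}(\alpha)=\frac{\left(21\alpha^3+299\alpha^2+1391\alpha+2073\right)^{1/6}(n+1)\left(n+\frac{5(\alpha+1)}{11}\right)}{(\alpha+1)(\alpha+3)^{1/2}(\alpha+5)^{1/3}\left[(\alpha+7)(\alpha+9)(\alpha+11)\right]^{1/6}}.$$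 -/

import Mathlib

noncomputable section

namespace LaguerreMarkov

/-- The Laguerre weight `w_α(x) = x^α e^{-x}` (used on `(0, ∞)`). -/
def weight (α x : ℝ) : ℝ := x ^ α * Real.exp (-x)

/-- The weighted `L₂` norm `(∫_0^∞ |f(x)|² w_α(x) dx)^{1/2}`. -/
def wnorm (α : ℝ) (f : ℝ → ℝ) : ℝ :=
  Real.sqrt (∫ x in Set.Ioi (0 : ℝ), |f x| ^ 2 * weight α x)

/-- The set of quotients `‖p'‖ / ‖p‖`, for nonzero real polynomials `p` of degree at most `n`. -/
def markovQuotients (n : ℕ) (α : ℝ) : Set ℝ :=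
  {r | ∃ p : Polynomial ℝ, p ≠ 0 ∧ p.natDegree ≤ n ∧
    r = wnorm α (fun x => p.derivative.eval x) / wnorm α (fun x => p.eval x)}

/-- The best Markov constant `c_n(α) = sup ‖p'‖ / ‖p‖`. -/
def markovConst (n : ℕ) (α : ℝ) : ℝ := sSup (markovQuotients n α)

/-- The squares of the lower bounds, for `k = 3, 4, 5, 6` (other values of `k` are not used). -/
def lowerSq (k : ℕ) (n α : ℝ) : ℝ :=
  match k with
  | 3 => 2 * n * (n + 3 * (α + 1) / 8) / ((α + 1) * (α + 5))
  | 4 => (5 * α + 17) * n * (n + 8 * (α + 1) / 25) / (2 * (α + 1) * (α + 3) * (α + 7))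
  | 5 => 2 * (7 * α + 31) * n * (n + 25 * (α + 1) / 84) / ((α + 1) * (α + 9) * (5 * α + 17))
  | 6 => (21 * α ^ 3 + 299 * α ^ 2 + 1391 * α + 2073) * n * (n + 2 * (α + 1) / 7) /
      ((α + 1) * (α + 3) * (α + 5) * (α + 11) * (7 * α + 31))
  | _ => 0

/-- The squares of the upper bounds, for `k = 3, 4, 5, 6` (other values of `k` are not used). -/
def upperSq (k : ℕ) (n α : ℝ) : ℝ :=
  match k with
  | 3 => (n + 1) * (n + 2 * (α + 1) / 5) /
      ((α + 1) * ((α + 3) * (α + 5)) ^ (1 / 3 : ℝ))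
  | 4 => (5 * α + 17) ^ (1 / 4 : ℝ) * (n + 1) * (n + 3 * (α + 1) / 7) /
      ((α + 1) * (α + 3) ^ (1 / 2 : ℝ) * (2 * (α + 5) * (α + 7)) ^ (1 / 4 : ℝ))
  | 5 => (7 * α + 31) ^ (1 / 5 : ℝ) * (n + 1) * (n + 4 * (α + 1) / 9) /
      ((α + 1) * (α + 3) ^ (2 / 5 : ℝ) * ((α + 5) * (α + 7) * (α + 9)) ^ (1 / 5 : ℝ))
  | 6 => (21 * α ^ 3 + 299 * α ^ 2 + 1391 * α + 2073) ^ (1 / 6 : ℝ) * (n + 1) *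
        (n + 5 * (α + 1) / 11) /
      ((α + 1) * (α + 3) ^ (1 / 2 : ℝ) * (α + 5) ^ (1 / 3 : ℝ) *
        ((α + 7) * (α + 9) * (α + 11)) ^ (1 / 6 : ℝ))
  | _ => 0

end LaguerreMarkov

end

/-! The derivatives of the polynomials `primitive α i` are `-laguerre α i`, which are mutually
orthogonal, and the primitives themselves are orthogonal to constants. After normalization, a
polynomial with coordinates `t` and constant part `c` has `‖p'‖² = t ⬝ᵥ t` and `‖p‖² = c² ‖1‖² + t
⬝ᵥ G *ᵥ t`, where `G` is the tridiagonal Gram matrix `gram α n`. Hence `c_n(α)²` is the largest of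
the reciprocals `μ i` of the eigenvalues of `G` (`exists_singular_values`).

For positive numbers the largest one lies between `p_k / p_{k-1}` and `p_k ^ (1/k)`, where `p_k = ∑
i, μ i ^ k` (`markovConst_bounds`). These power sums need no knowledge of the individual
eigenvalues: `∏ (1 - μ i X)` is the normalized characteristic polynomial `secular α n`
(`gram_charpoly`). Its three-term recurrence in `n` yields its low coefficients as explicit rational
functions of `n` and `α` (`secular_coeff`), and Newton's identities turn these into the power sums
(`sum_pow_eq`).

What remains is a pair of polynomial inequalities in `x = n` and `a = α + 1` for each `k`. After the
substitution `x = y + 1`, they follow from the nonnegativity of all coefficients. -/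

namespace LaguerreMarkov

open Polynomial MeasureTheory

/-! ### Moments of the Laguerre weight and integration by parts. -/

/-- The linear functional on polynomials with moments `X ^ m ↦ Γ(m + α + 1)`. -/
noncomputable def moment (α : ℝ) : ℝ[X] →ₗ[ℝ] ℝ :=
  (Polynomial.basisMonomials ℝ).constr ℝ fun m : ℕ => Real.Gamma (m + α + 1)

theorem moment_monomial (α : ℝ) (m : ℕ) (c : ℝ) :
    moment α (monomial m c) = c * Real.Gamma (m + α + 1) := by
  have h : (monomial m c : ℝ[X]) = c • Polynomial.basisMonomials ℝ m := by
    simp [smul_monomial]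
  rw [h, map_smul, moment, Module.Basis.constr_basis, smul_eq_mul]

theorem integrableOn_pow_mul_weight {α : ℝ} (hα : -1 < α) (m : ℕ) :
    IntegrableOn (fun x => x ^ m * weight α x) (Set.Ioi 0) := by
  have hs : 0 < (m : ℝ) + α + 1 := by
    have : (0 : ℝ) ≤ m := m.cast_nonneg
    linarith
  refine (Real.GammaIntegral_convergent hs).congr_fun (fun x hx => ?_) measurableSet_Ioi
  have hx : (0 : ℝ) < x := hx
  simp only [weight]
  rw [← Real.rpow_natCast, ← mul_assoc, ← Real.rpow_add hx, mul_comm]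
  congr 2; ring

theorem integral_pow_mul_weight {α : ℝ} (hα : -1 < α) (m : ℕ) :
    ∫ x in Set.Ioi (0 : ℝ), x ^ m * weight α x = Real.Gamma (m + α + 1) := by
  have hs : 0 < (m : ℝ) + α + 1 := by
    have : (0 : ℝ) ≤ m := m.cast_nonneg
    linarith
  rw [Real.Gamma_eq_integral hs]
  refine setIntegral_congr_fun measurableSet_Ioi (fun x hx => ?_)
  have hx : (0 : ℝ) < x := hx
  simp only [weight]
  rw [← Real.rpow_natCast, ← mul_assoc, ← Real.rpow_add hx, mul_comm]
  congr 2; ring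

theorem integral_eval_mul_weight {α : ℝ} (hα : -1 < α) (p : ℝ[X]) :
    ∫ x in Set.Ioi (0 : ℝ), p.eval x * weight α x = moment α p := by
  have h1 : ∀ x, p.eval x * weight α x =
      ∑ i ∈ Finset.range (p.natDegree + 1), p.coeff i * (x ^ i * weight α x) := by
    intro x
    rw [eval_eq_sum_range, Finset.sum_mul]
    exact Finset.sum_congr rfl fun i _ => by ring
  simp only [h1]
  rw [integral_finsetSum _ fun i _ => (integrableOn_pow_mul_weight hα i).const_mul _]
  conv_rhs => rw [p.as_sum_range, map_sum]
  exact Finset.sum_congr rfl fun i _ => by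
    rw [integral_const_mul, integral_pow_mul_weight hα, moment_monomial]

theorem wnorm_eval {α : ℝ} (hα : -1 < α) (p : ℝ[X]) :
    wnorm α (fun x => p.eval x) = Real.sqrt (moment α (p * p)) := by
  rw [wnorm, ← integral_eval_mul_weight hα]
  congr 2 with x
  rw [sq_abs, eval_mul, sq]

theorem moment_mul_self_nonneg {α : ℝ} (hα : -1 < α) (p : ℝ[X]) : 0 ≤ moment α (p * p) := by
  rw [← integral_eval_mul_weight hα]
  refine setIntegral_nonneg measurableSet_Ioi fun x hx => ?_
  have hx : (0 : ℝ) < x := hx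
  rw [eval_mul, weight]
  exact mul_nonneg (mul_self_nonneg _) (by positivity)

theorem moment_C_mul (α c : ℝ) (p : ℝ[X]) : moment α (C c * p) = c * moment α p := by
  rw [← smul_eq_C_mul, map_smul, smul_eq_mul]

/-- Integration by parts. -/
theorem moment_X_mul_derivative {α : ℝ} (hα : -1 < α) (p : ℝ[X]) :
    moment α (X * derivative p) = moment α ((X - C (α + 1)) * p) := by
  induction p using Polynomial.induction_on' with
  | add p q hp hq => simp only [mul_add, map_add, hp, hq]
  | monomial m c =>
    have hs : (m : ℝ) + α + 1 ≠ 0 := by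
      have : (0 : ℝ) ≤ m := m.cast_nonneg
      linarith
    have hX : (X : ℝ[X]) * derivative (monomial m c) = monomial m (c * m) := by
      cases m with
      | zero => simp
      | succ m => rw [derivative_monomial, X_mul_monomial]; simp
    rw [hX, sub_mul, map_sub, X_mul_monomial, C_mul_monomial, moment_monomial, moment_monomial,
      moment_monomial]
    -- On monomials, integration by parts is the functional equation of `Γ`.
    have := Real.Gamma_add_one hs
    rw [show ((m + 1 : ℕ) : ℝ) + α + 1 = (m + α + 1) + 1 by push_cast; ring, this]
    ring

/-! ### Laguerre polynomials: differential equation, orthogonality, norms. -/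

/-- The Laguerre polynomials `L_n^{(α)}`. -/
noncomputable def laguerre (α : ℝ) : ℕ → ℝ[X]
  | 0 => 1
  | n + 1 => C ((n + 1 : ℝ)⁻¹) *
      ((C (n + 1 + α) - X) * laguerre α n + X * derivative (laguerre α n))

theorem laguerre_zero (α : ℝ) : laguerre α 0 = 1 := rfl

theorem succ_mul_laguerre_succ (α : ℝ) (n : ℕ) :
    C (n + 1 : ℝ) * laguerre α (n + 1) =
      (C (n + 1 + α) - X) * laguerre α n + X * derivative (laguerre α n) := by
  have h : (n + 1 : ℝ) ≠ 0 := by positivity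
  rw [laguerre, ← mul_assoc, ← C_mul, mul_inv_cancel₀ h, C_1, one_mul]

/-- Differentiating the defining recurrence produces the second-order terms of the differential
equation at `n`. The equation is kept as a hypothesis because its own induction step needs this
relation. -/
theorem derivative_laguerre_succ_of_ode (α : ℝ) (n : ℕ)
    (h : X * derivative (derivative (laguerre α n)) + (C (α + 1) - X) * derivative (laguerre α n) +
      C (n : ℝ) * laguerre α n = 0) :
    derivative (laguerre α (n + 1)) = derivative (laguerre α n) - laguerre α n := by
  have h1 : (C (n + 1 : ℝ) : ℝ[X]) ≠ 0 := by
    rw [Ne, C_eq_zero]; positivity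
  apply mul_left_cancel₀ h1
  have h2 := congrArg derivative (succ_mul_laguerre_succ α n)
  simp only [derivative_mul, derivative_add, derivative_sub, derivative_C, derivative_X] at h2
  simp only [C_add, C_1] at *
  linear_combination h2 + h

theorem laguerre_ode (α : ℝ) (n : ℕ) :
    X * derivative (derivative (laguerre α n)) + (C (α + 1) - X) * derivative (laguerre α n) +
      C (n : ℝ) * laguerre α n = 0 := by
  induction n with
  | zero => simp [laguerre_zero]
  | succ n ih =>
    have hd := derivative_laguerre_succ_of_ode α n ih
    have hs := succ_mul_laguerre_succ α n
    rw [hd, derivative_sub]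
    push_cast
    simp only [C_add, C_1] at *
    linear_combination ih + hs

theorem derivative_laguerre_succ (α : ℝ) (n : ℕ) :
    derivative (laguerre α (n + 1)) = derivative (laguerre α n) - laguerre α n :=
  derivative_laguerre_succ_of_ode α n (laguerre_ode α n)

/-- The differential equation in self-adjoint form, tested against `q`. For `q = laguerre α j` the
left side is symmetric in `i` and `j`, which forces orthogonality when `i ≠ j`. -/
theorem moment_X_mul_derivative_laguerre_mul {α : ℝ} (hα : -1 < α) (i : ℕ) (q : ℝ[X]) :
    moment α (X * (derivative (laguerre α i) * derivative q)) =
      i * moment α (laguerre α i * q) := by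
  have h := moment_X_mul_derivative hα (derivative (laguerre α i) * q)
  have h0 := laguerre_ode α i
  rw [← sub_eq_zero, ← map_sub] at h
  rw [← moment_C_mul, ← sub_eq_zero, ← map_sub, ← h]
  congr 1
  rw [derivative_mul]
  linear_combination (-q) * h0

theorem moment_laguerre_mul_of_ne {α : ℝ} (hα : -1 < α) {i j : ℕ} (hij : i ≠ j) :
    moment α (laguerre α i * laguerre α j) = 0 := by
  have h1 := moment_X_mul_derivative_laguerre_mul hα i (laguerre α j)
  have h2 := moment_X_mul_derivative_laguerre_mul hα j (laguerre α i)
  rw [mul_comm (derivative (laguerre α j)), h1, mul_comm (laguerre α j)] at h2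
  have h3 : ((i : ℝ) - j) * moment α (laguerre α i * laguerre α j) = 0 := by linarith
  exact (mul_eq_zero.mp h3).resolve_left (sub_ne_zero.mpr (Nat.cast_injective.ne hij))

/-- The squared norm of the `n`-th Laguerre polynomial. -/
noncomputable def normSq (α : ℝ) (n : ℕ) : ℝ := moment α (laguerre α n * laguerre α n)

/-- Integration by parts is applied to the product of two consecutive Laguerre polynomials; the
cross term vanishes by orthogonality, leaving only the two squares. -/
theorem normSq_succ {α : ℝ} (hα : -1 < α) (n : ℕ) :
    (n + 1) * normSq α (n + 1) = (n + 1 + α) * normSq α n := by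
  have h0 : moment α (laguerre α n * laguerre α (n + 1)) = 0 :=
    moment_laguerre_mul_of_ne hα (Nat.lt_succ_self n).ne
  have hp := moment_X_mul_derivative hα (laguerre α n * laguerre α (n + 1))
  have e1 : X * derivative (laguerre α n * laguerre α (n + 1)) -
      (X - C (α + 1)) * (laguerre α n * laguerre α (n + 1)) =
      C (n + 1 : ℝ) * (laguerre α (n + 1) * laguerre α (n + 1)) -
      C (n + 1 + α) * (laguerre α n * laguerre α n) +
      laguerre α n * laguerre α (n + 1) := by
    have hd := derivative_laguerre_succ α n
    have hs := succ_mul_laguerre_succ α n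
    rw [derivative_mul, hd]
    simp only [C_add, C_1] at *
    linear_combination (-laguerre α n - laguerre α (n + 1)) * hs
  rw [← sub_eq_zero, ← map_sub, e1, map_add, map_sub, moment_C_mul, moment_C_mul, h0] at hp
  simp only [normSq]
  linarith

theorem normSq_pos {α : ℝ} (hα : -1 < α) (n : ℕ) : 0 < normSq α n := by
  induction n with
  | zero =>
    have : normSq α 0 = Real.Gamma (α + 1) := by
      have := moment_monomial α 0 1
      simpa [normSq, laguerre_zero] using this
    rw [this]
    exact Real.Gamma_pos_of_pos (by linarith)
  | succ n ih =>
    have h := normSq_succ hα n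
    have h1 : (0 : ℝ) < n + 1 := by positivity
    have h2 : (0 : ℝ) < n + 1 + α := by
      have : (0 : ℝ) ≤ n := n.cast_nonneg
      linarith
    exact (mul_pos_iff_of_pos_left h1).mp (h ▸ mul_pos h2 ih)

theorem natDegree_laguerre_le (α : ℝ) (n : ℕ) : (laguerre α n).natDegree ≤ n := by
  induction n with
  | zero => simp [laguerre_zero]
  | succ n ih =>
    rw [laguerre]
    refine (natDegree_C_mul_le _ _).trans (natDegree_add_le_of_degree_le ?_ ?_)
    · refine natDegree_mul_le.trans ?_
      have : (C ((n : ℝ) + 1 + α) - X : ℝ[X]).natDegree ≤ 1 := by compute_degree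
      omega
    · refine natDegree_mul_le.trans ?_
      have := natDegree_derivative_le (laguerre α n)
      have := natDegree_X_le (R := ℝ)
      omega

theorem coeff_laguerre_self_ne_zero (α : ℝ) (n : ℕ) : (laguerre α n).coeff n ≠ 0 := by
  induction n with
  | zero => simp [laguerre_zero]
  | succ n ih =>
    have h1 : (laguerre α n).coeff (n + 1) = 0 :=
      coeff_eq_zero_of_natDegree_lt (by have := natDegree_laguerre_le α n; omega)
    have h : (laguerre α (n + 1)).coeff (n + 1) = -((n + 1 : ℝ)⁻¹ * (laguerre α n).coeff n) := by
      rw [laguerre, coeff_C_mul, coeff_add, sub_mul, coeff_sub, coeff_C_mul, coeff_X_mul,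
        coeff_X_mul, coeff_derivative, h1]
      ring
    rw [h]
    exact neg_ne_zero.mpr (mul_ne_zero (by positivity) ih)

/-- The Laguerre polynomials span the polynomials of bounded degree. -/
theorem exists_eq_sum_laguerre (α : ℝ) (n : ℕ) (p : ℝ[X]) (hp : p.degree < n) :
    ∃ s : ℕ → ℝ, p = ∑ i ∈ Finset.range n, C (s i) * laguerre α i := by
  induction n generalizing p with
  | zero => exact ⟨0, by simpa using hp⟩
  | succ n ih =>
    set c := p.coeff n / (laguerre α n).coeff n with hc
    have hd : (p - C c * laguerre α n).degree < n := by
      rw [degree_lt_iff_coeff_zero] at hp ⊢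
      intro m hm
      rw [coeff_sub, coeff_C_mul]
      rcases hm.eq_or_lt with rfl | hm
      · rw [hc, div_mul_cancel₀ _ (coeff_laguerre_self_ne_zero α n), sub_self]
      · rw [hp m hm, coeff_eq_zero_of_natDegree_lt ((natDegree_laguerre_le α n).trans_lt hm)]
        simp
    obtain ⟨s, hs⟩ := ih _ hd
    refine ⟨fun i => if i = n then c else s i, ?_⟩
    rw [Finset.sum_range_succ]
    simp only [if_pos]
    rw [← sub_eq_iff_eq_add, hs]
    exact Finset.sum_congr rfl fun i hi => by rw [if_neg (Finset.mem_range.mp hi).ne]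

end LaguerreMarkov

namespace LaguerreMarkov

open Polynomial Matrix

/-! ### Determinants of tridiagonal matrices. -/

section Tridiagonal

variable {R : Type*} [CommRing R]

/-- The symmetric tridiagonal matrix with diagonal `d` and off-diagonal `b`. -/
def tridiag (d b : ℕ → R) (n : ℕ) : Matrix (Fin n) (Fin n) R :=
  Matrix.of fun i j =>
    if (i : ℕ) = j then d i else if (i : ℕ) + 1 = j then b i else if (j : ℕ) + 1 = i then b j else 0

theorem tridiag_submatrix_castSucc (d b : ℕ → R) (n : ℕ) :
    (tridiag d b (n + 1)).submatrix Fin.castSucc Fin.castSucc = tridiag d b n := by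
  ext i j; simp [tridiag]

/-- Laplace expansion along the last row leaves two minors; the off-diagonal one is expanded once
more along its last column. -/
theorem det_tridiag_succ_succ (d b : ℕ → R) (n : ℕ) :
    (tridiag d b (n + 2)).det =
      d (n + 1) * (tridiag d b (n + 1)).det - b n ^ 2 * (tridiag d b n).det := by
  have hlast : (Fin.last (n + 1)).succAbove = Fin.castSucc := Fin.succAbove_last
  have hminor : ((tridiag d b (n + 2)).submatrix Fin.castSucc
      (Fin.last n).castSucc.succAbove).det = b n * (tridiag d b n).det := by
    rw [det_succ_column _ (Fin.last n), Fin.sum_univ_castSucc,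
      Finset.sum_eq_zero]
    · simp only [submatrix_submatrix, Fin.succAbove_last, zero_add, submatrix_apply]
      have h1 : (Fin.last n).castSucc.succAbove (Fin.last n) = Fin.last (n + 1) := by
        ext; simp [Fin.succAbove]
      have h2 : (Fin.last n).castSucc.succAbove ∘ Fin.castSucc =
          Fin.castSucc ∘ (Fin.castSucc : Fin n → Fin (n + 1)) := by
        funext i; ext; simp [Fin.succAbove, Fin.lt_def]
      rw [h1, h2, ← submatrix_submatrix, tridiag_submatrix_castSucc, tridiag_submatrix_castSucc]
      simp [tridiag, ← two_mul]
    · intro i _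
      have h1 : (Fin.last n).castSucc.succAbove (Fin.last n) = Fin.last (n + 1) := by
        ext; simp [Fin.succAbove]
      have hi := i.isLt
      have h3 : tridiag d b (n + 2) i.castSucc.castSucc (Fin.last (n + 1)) = 0 := by
        simp only [tridiag, of_apply, Fin.val_castSucc, Fin.val_last]
        rw [if_neg (by omega), if_neg (by omega), if_neg (by omega)]
      rw [submatrix_apply, h1, h3]; ring
  rw [det_succ_row _ (Fin.last (n + 1)), Fin.sum_univ_castSucc, Fin.sum_univ_castSucc,
    Finset.sum_eq_zero]
  · rw [hlast, hminor, tridiag_submatrix_castSucc]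
    have h1 : tridiag d b (n + 2) (Fin.last (n + 1)) (Fin.last (n + 1)) = d (n + 1) := by
      simp [tridiag]
    have h2 : tridiag d b (n + 2) (Fin.last (n + 1)) (Fin.last n).castSucc = b n := by
      simp only [tridiag, of_apply, Fin.val_castSucc, Fin.val_last]
      rw [if_neg (by omega), if_neg (by omega), if_pos trivial]
    have h3 : (-1 : R) ^ (n + 1 + n) = -1 := Odd.neg_one_pow ⟨n, by ring⟩
    have h4 : (-1 : R) ^ (n + 1 + (n + 1)) = 1 := Even.neg_one_pow ⟨n + 1, rfl⟩
    rw [h1, h2, Fin.val_castSucc, Fin.val_last, Fin.val_last, h3, h4]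
    ring
  · intro i _
    have hi := i.isLt
    have h3 : tridiag d b (n + 2) (Fin.last (n + 1)) i.castSucc.castSucc = 0 := by
      simp only [tridiag, of_apply, Fin.val_castSucc, Fin.val_last]
      rw [if_neg (by omega), if_neg (by omega), if_neg (by omega)]
    rw [h3]; ring

theorem charmatrix_tridiag (d b : ℕ → R) (n : ℕ) :
    (tridiag d b n).charmatrix = tridiag (fun i => X - C (d i)) (fun i => -C (b i)) n := by
  ext1 i j
  rw [charmatrix_apply]
  by_cases h : i = j
  · subst h; simp [tridiag]
  · have h' : (i : ℕ) ≠ j := fun e => h (Fin.ext e)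
    simp only [tridiag, of_apply, if_neg h', diagonal_apply_ne _ h]
    split_ifs <;> simp

theorem charpoly_tridiag_succ_succ (d b : ℕ → R) (n : ℕ) :
    (tridiag d b (n + 2)).charpoly =
      (X - C (d (n + 1))) * (tridiag d b (n + 1)).charpoly -
        C (b n ^ 2) * (tridiag d b n).charpoly := by
  simp only [charpoly, charmatrix_tridiag, det_tridiag_succ_succ]
  simp

end Tridiagonal

/-! ### Reciprocal roots and Newton's identities. -/

section ReciprocalRoots

variable {ι : Type*}

theorem eq_prod_one_sub_inv_mul_X (s : Finset ι) (τ : ι → ℝ) (c : ℝ) (D : ℝ[X]) (hc : c ≠ 0)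
    (hD : D.coeff 0 = 1) (h : ∏ i ∈ s, (X - C (τ i)) = C c * D) :
    (∀ i ∈ s, τ i ≠ 0) ∧ ∏ i ∈ s, (1 - C (τ i)⁻¹ * X) = D := by
  -- Evaluation at `0` identifies `c`, so `c ≠ 0` excludes zero roots.
  have h0 : ∏ i ∈ s, (-τ i) = c := by
    have := congrArg (eval 0) h
    rw [eval_prod, eval_mul, eval_C, ← coeff_zero_eq_eval_zero, hD, mul_one] at this
    simpa using this
  have hτ : ∀ i ∈ s, τ i ≠ 0 := fun i hi => by
    rw [← h0, Finset.prod_ne_zero_iff] at hc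
    exact neg_ne_zero.mp (hc i hi)
  refine ⟨hτ, mul_left_cancel₀ (C_ne_zero.mpr hc) ?_⟩
  rw [← h]
  conv_lhs => rw [← h0, map_prod, ← Finset.prod_mul_distrib]
  refine Finset.prod_congr rfl fun i hi => ?_
  have : (C (τ i) * C (τ i)⁻¹ : ℝ[X]) = 1 := by rw [← C_mul, mul_inv_cancel₀ (hτ i hi), C_1]
  rw [C_neg]
  linear_combination X * this

/-- Newton's identities, in terms of the coefficients of `∏ (1 - μ i X)`. -/
theorem newton_coeff_prod_one_sub [DecidableEq ι] (s : Finset ι) (μ : ι → ℝ) (m : ℕ) :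
    (m + 1) * (∏ i ∈ s, (1 - C (μ i) * X)).coeff (m + 1) =
      -∑ j ∈ Finset.range (m + 1),
        (∏ i ∈ s, (1 - C (μ i) * X)).coeff j * ∑ i ∈ s, μ i ^ (m + 1 - j) := by
  set D : ℝ[X] := ∏ i ∈ s, (1 - C (μ i) * X) with hD
  set P : ℝ[X] := ∑ k ∈ Finset.range (m + 1), C (∑ i ∈ s, μ i ^ (k + 1)) * X ^ k with hP
  have hP' : P = ∑ i ∈ s, C (μ i) * ∑ k ∈ Finset.range (m + 1), (C (μ i) * X) ^ k := by
    simp only [hP, map_sum, Finset.sum_mul, Finset.mul_sum]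
    rw [Finset.sum_comm]
    refine Finset.sum_congr rfl fun i _ => Finset.sum_congr rfl fun k _ => ?_
    rw [C_pow]; ring
  -- The logarithmic derivative `D' = -D ∑ μ i / (1 - μ i X)`, with each geometric series cut after
  -- `X ^ m`. The remainder is a multiple of `X ^ (m + 1)` and is invisible in the coefficient of `X
  -- ^ m`.
  have key : derivative D = -(D * P) -
      X ^ (m + 1) * ∑ i ∈ s, C (μ i) * C (μ i) ^ (m + 1) * ∏ j ∈ s.erase i, (1 - C (μ j) * X) := by
    rw [hD, derivative_prod_finset, hP', Finset.mul_sum, Finset.mul_sum, ← Finset.sum_neg_distrib,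
      ← Finset.sum_sub_distrib]
    refine Finset.sum_congr rfl fun i hi => ?_
    have hg := mul_neg_geom_sum (C (μ i) * X : ℝ[X]) (m + 1)
    rw [← Finset.mul_prod_erase s _ hi]
    simp only [derivative_sub, derivative_one, derivative_mul, derivative_C, derivative_X]
    linear_combination (C (μ i) * ∏ j ∈ s.erase i, (1 - C (μ j) * X)) * hg
  have hc := congrArg (fun q => coeff q m) key
  simp only [coeff_derivative, coeff_sub, coeff_neg, coeff_X_pow_mul', coeff_mul D P] at hc
  rw [if_neg (by omega), sub_zero, Finset.Nat.sum_antidiagonal_eq_sum_range_succ_mk] at hc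
  rw [mul_comm, hc]
  congr 1
  refine Finset.sum_congr rfl fun j hj => ?_
  have hj : j ≤ m := Nat.lt_succ_iff.mp (Finset.mem_range.mp hj)
  congr 1
  simp only [hP, finsetSum_coeff, coeff_C_mul_X_pow]
  rw [Finset.sum_ite_eq, if_pos (Finset.mem_range.mpr (by omega)), Nat.sub_add_comm hj]

end ReciprocalRoots

/-! ### Rayleigh quotients of real symmetric matrices. -/

section Rayleigh

variable {n : Type*} [Fintype n] [DecidableEq n] {A : Matrix n n ℝ}

theorem _root_.Matrix.IsHermitian.le_dotProduct_mulVec (hA : A.IsHermitian) {c : ℝ}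
    (hc : ∀ i, c ≤ hA.eigenvalues i) (t : n → ℝ) : c * (t ⬝ᵥ t) ≤ t ⬝ᵥ A *ᵥ t := by
  set v : n → ℝ := (star (hA.eigenvectorUnitary : Matrix n n ℝ)) *ᵥ t with hv
  have hU : (hA.eigenvectorUnitary : Matrix n n ℝ) *
      star (hA.eigenvectorUnitary : Matrix n n ℝ) = 1 :=
    Unitary.mul_star_self_of_mem hA.eigenvectorUnitary.2
  have hvt : v = t ᵥ* (hA.eigenvectorUnitary : Matrix n n ℝ) := by
    rw [hv, star_eq_conjTranspose, conjTranspose_eq_transpose_of_trivial, mulVec_transpose]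
  have h1 : t ⬝ᵥ t = v ⬝ᵥ v := by
    nth_rewrite 1 [hvt]
    rw [hv, ← dotProduct_mulVec, mulVec_mulVec, hU, one_mulVec]
  have h2 : t ⬝ᵥ A *ᵥ t = v ⬝ᵥ (diagonal hA.eigenvalues *ᵥ v) := by
    nth_rewrite 1 [hvt]
    rw [hv, ← dotProduct_mulVec, mulVec_mulVec, mulVec_mulVec]
    conv_lhs => rw [hA.spectral_theorem, Unitary.conjStarAlgAut_apply]
    simp [Matrix.mul_assoc]
  rw [h1, h2]
  simp only [dotProduct, mulVec_diagonal, Finset.mul_sum]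
  refine Finset.sum_le_sum fun i _ => ?_
  nlinarith [hc i, mul_self_nonneg (v i)]

theorem _root_.Matrix.IsHermitian.exists_eigenvector (hA : A.IsHermitian) (i : n) :
    ∃ t : n → ℝ, t ⬝ᵥ t = 1 ∧ t ⬝ᵥ A *ᵥ t = hA.eigenvalues i := by
  refine ⟨hA.eigenvectorBasis i, ?_, ?_⟩
  · have h := hA.eigenvectorBasis.orthonormal.1 i
    have h2 := real_inner_self_eq_norm_sq (hA.eigenvectorBasis i)
    rw [h, EuclideanSpace.inner_eq_star_dotProduct] at h2
    simpa using h2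
  · have := hA.eigenvalues_eq i
    simpa using this.symm

end Rayleigh

end LaguerreMarkov

/-! ### The Gram matrix of the primitives and the extremal problem. -/

namespace LaguerreMarkov

open Polynomial Matrix

/-- Polynomials orthogonal to the constants whose derivatives are `-L_i`. -/
noncomputable def primitive (α : ℝ) (i : ℕ) : ℝ[X] :=
  laguerre α (i + 1) - if i = 0 then 0 else laguerre α i

theorem derivative_primitive (α : ℝ) (i : ℕ) : derivative (primitive α i) = -laguerre α i := by
  rw [primitive, derivative_sub, derivative_laguerre_succ]
  split_ifs with h
  · subst h; simp [laguerre_zero]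
  · ring

theorem natDegree_primitive_le (α : ℝ) (i : ℕ) : (primitive α i).natDegree ≤ i + 1 := by
  rw [primitive]
  refine (natDegree_sub_le _ _).trans (max_le (natDegree_laguerre_le α _) ?_)
  split_ifs
  · simp
  · exact (natDegree_laguerre_le α i).trans i.le_succ

/-- Diagonal of the Gram matrix of the normalized primitives. -/
noncomputable def gramDiag (α : ℝ) (i : ℕ) : ℝ :=
  (normSq α (i + 1) + if i = 0 then 0 else normSq α i) / normSq α i

/-- Off-diagonal of the Gram matrix of the normalized primitives. -/
noncomputable def gramOff (α : ℝ) (i : ℕ) : ℝ := -√(normSq α (i + 1) / normSq α i)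

/-- The Gram matrix of the normalized primitives. -/
noncomputable def gram (α : ℝ) (n : ℕ) : Matrix (Fin n) (Fin n) ℝ :=
  tridiag (gramDiag α) (gramOff α) n

theorem isHermitian_gram (α : ℝ) (n : ℕ) : (gram α n).IsHermitian := by
  ext i j
  simp only [gram, tridiag, conjTranspose_apply, of_apply, star_trivial]
  by_cases h : (j : ℕ) = i
  · rw [if_pos h, if_pos h.symm, h]
  · rw [if_neg h, if_neg (Ne.symm h)]
    split_ifs <;> first | rfl | omega

theorem moment_laguerre_mul {α : ℝ} (hα : -1 < α) (i j : ℕ) :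
    moment α (laguerre α i * laguerre α j) = if i = j then normSq α i else 0 := by
  split_ifs with h
  · subst h; rfl
  · exact moment_laguerre_mul_of_ne hα h

theorem moment_primitive {α : ℝ} (hα : -1 < α) (i : ℕ) : moment α (primitive α i) = 0 := by
  have h (j : ℕ) (hj : j ≠ 0) : moment α (laguerre α j) = 0 := by
    simpa [laguerre_zero] using moment_laguerre_mul_of_ne hα hj
  rw [primitive, map_sub, h _ i.succ_ne_zero]
  split_ifs with hi
  · simp
  · rw [h _ hi, sub_zero]

/-- Distinct primitives share a Laguerre component only when their indices are adjacent; this makes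
the Gram matrix tridiagonal. Index `0` is special since its constant component is removed. -/
theorem moment_primitive_mul_of_le {α : ℝ} (hα : -1 < α) {i j : ℕ} (hij : i ≤ j) :
    moment α (primitive α i * primitive α j) =
      √(normSq α i) * √(normSq α j) *
        if i = j then gramDiag α i else if i + 1 = j then gramOff α i else 0 := by
  have hi := normSq_pos hα i
  have hi1 := normSq_pos hα (i + 1)
  rcases hij.eq_or_lt with rfl | hlt
  · rw [if_pos rfl, Real.mul_self_sqrt hi.le, gramDiag, mul_div_cancel₀ _ hi.ne', primitive]
    split_ifs with h
    · simp [moment_laguerre_mul hα]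
    · rw [sub_mul, mul_sub, mul_sub]
      simp [moment_laguerre_mul hα]
  · rw [if_neg hlt.ne]
    have hj : j ≠ 0 := by omega
    simp only [primitive, if_neg hj]
    have e : moment α ((laguerre α (i + 1) - if i = 0 then 0 else laguerre α i) *
        (laguerre α (j + 1) - laguerre α j)) = if i + 1 = j then -normSq α (i + 1) else 0 := by
      split_ifs with h1 h2 h2 <;> rw [sub_mul, mul_sub] <;> try rw [mul_sub]
      all_goals simp only [map_sub, zero_mul, map_zero, moment_laguerre_mul hα]
      all_goals simp only [show i ≠ j by omega, show i ≠ j + 1 by omega, if_false,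
        show i + 1 ≠ j + 1 by omega]
      all_goals simp [h2]
    rw [e]
    split_ifs with h
    · subst h
      rw [gramOff, Real.sqrt_div hi1.le, mul_neg, mul_comm √(normSq α i), mul_assoc,
        mul_div_cancel₀ _ (Real.sqrt_pos.mpr hi).ne', Real.mul_self_sqrt hi1.le]
    · simp

theorem moment_primitive_mul {α : ℝ} (hα : -1 < α) {n : ℕ} (i j : Fin n) :
    moment α (primitive α i * primitive α j) =
      √(normSq α i) * √(normSq α j) * gram α n i j := by
  rcases le_total (i : ℕ) j with h | h
  · rw [moment_primitive_mul_of_le hα h]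
    simp only [gram, tridiag, of_apply]
    split_ifs <;> first | rfl | omega
  · rw [mul_comm (primitive α i), moment_primitive_mul_of_le hα h]
    have hs := (isHermitian_gram α n).apply j i
    rw [star_trivial] at hs
    rw [hs, mul_comm √(normSq α i)]
    simp only [gram, tridiag, of_apply]
    split_ifs <;> first | rfl | omega

/-- The polynomial with constant component `c` and with coordinates `t` in the basis of normalized
primitives. -/
noncomputable def ofCoords (α : ℝ) {n : ℕ} (c : ℝ) (t : Fin n → ℝ) : ℝ[X] :=
  C c + ∑ i, C (t i / √(normSq α i)) * primitive α i

theorem derivative_ofCoords (α : ℝ) {n : ℕ} (c : ℝ) (t : Fin n → ℝ) :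
    derivative (ofCoords α c t) = -∑ i, C (t i / √(normSq α i)) * laguerre α i := by
  simp [ofCoords, derivative_primitive]

theorem natDegree_ofCoords_le (α : ℝ) {n : ℕ} (c : ℝ) (t : Fin n → ℝ) :
    (ofCoords α c t).natDegree ≤ n := by
  rw [ofCoords]
  refine natDegree_add_le_of_degree_le (by simp) (natDegree_sum_le_of_forall_le _ _ fun i _ => ?_)
  exact (natDegree_C_mul_le _ _).trans ((natDegree_primitive_le α i).trans i.isLt)

theorem moment_derivative_ofCoords_mul_self {α : ℝ} (hα : -1 < α) {n : ℕ} (c : ℝ)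
    (t : Fin n → ℝ) :
    moment α (derivative (ofCoords α c t) * derivative (ofCoords α c t)) = t ⬝ᵥ t := by
  rw [derivative_ofCoords, neg_mul_neg, Finset.sum_mul_sum]
  simp only [map_sum, dotProduct]
  refine Finset.sum_congr rfl fun i _ => ?_
  rw [Finset.sum_eq_single i]
  · have hi := normSq_pos hα i
    have hs := (Real.sqrt_pos.mpr hi).ne'
    have hm := Real.mul_self_sqrt hi.le
    rw [mul_mul_mul_comm, ← C_mul, moment_C_mul, moment_laguerre_mul hα, if_pos rfl,
      div_mul_div_comm, hm, div_mul_cancel₀ _ hi.ne']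
  · intro j _ hj
    rw [mul_mul_mul_comm, ← C_mul, moment_C_mul, moment_laguerre_mul hα,
      if_neg fun h => hj (Fin.ext h).symm, mul_zero]
  · simp

theorem moment_ofCoords_mul_self {α : ℝ} (hα : -1 < α) {n : ℕ} (c : ℝ) (t : Fin n → ℝ) :
    moment α (ofCoords α c t * ofCoords α c t) =
      c ^ 2 * normSq α 0 + t ⬝ᵥ gram α n *ᵥ t := by
  set q : ℝ[X] := ∑ i, C (t i / √(normSq α i)) * primitive α i with hq
  have h1 : moment α q = 0 := by
    rw [hq, map_sum]
    exact Finset.sum_eq_zero fun i _ => by rw [moment_C_mul, moment_primitive hα, mul_zero]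
  have h2 : moment α (q * q) = t ⬝ᵥ gram α n *ᵥ t := by
    rw [hq, Finset.sum_mul_sum]
    simp only [map_sum, dotProduct, mulVec, Finset.mul_sum]
    refine Finset.sum_congr rfl fun i _ => Finset.sum_congr rfl fun j _ => ?_
    have hi := (Real.sqrt_pos.mpr (normSq_pos hα i)).ne'
    have hj := (Real.sqrt_pos.mpr (normSq_pos hα j)).ne'
    rw [mul_mul_mul_comm, ← C_mul, moment_C_mul, moment_primitive_mul hα]
    field_simp
  have h3 : ofCoords α c t * ofCoords α c t = C (c ^ 2) * (laguerre α 0 * laguerre α 0) +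
      C (2 * c) * q + q * q := by
    rw [ofCoords, ← hq, laguerre_zero]
    simp only [C_pow, C_mul]
    rw [show (C (2 : ℝ) : ℝ[X]) = 2 from rfl]
    ring
  rw [h3, map_add, map_add, moment_C_mul, moment_C_mul, h1, h2, mul_zero, add_zero, normSq]

/-- The coordinates are read off from the Laguerre expansion of `p'`; only a constant is then left
undetermined. -/
theorem exists_eq_ofCoords {α : ℝ} (hα : -1 < α) {n : ℕ} (hn : 0 < n) (p : ℝ[X])
    (hp : p.natDegree ≤ n) : ∃ (c : ℝ) (t : Fin n → ℝ), p = ofCoords α c t := by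
  have hd : (derivative p).degree < n := by
    refine degree_le_natDegree.trans_lt (Nat.cast_lt.mpr ?_)
    have := natDegree_derivative_le p
    omega
  obtain ⟨s, hs⟩ := exists_eq_sum_laguerre α n _ hd
  set t : Fin n → ℝ := fun i => -s i * √(normSq α i) with ht
  have h0 : derivative (p - ofCoords α 0 t) = 0 := by
    rw [derivative_sub, derivative_ofCoords, hs, Finset.sum_range, sub_neg_eq_add,
      ← Finset.sum_add_distrib]
    refine Finset.sum_eq_zero fun i _ => ?_
    rw [ht, mul_div_cancel_right₀ _ (Real.sqrt_pos.mpr (normSq_pos hα i)).ne', C_neg]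
    ring
  obtain ⟨c, hc⟩ : ∃ c, p - ofCoords α 0 t = C c :=
    ⟨_, eq_C_of_natDegree_eq_zero (derivative_eq_zero.mp h0)⟩
  refine ⟨c, t, ?_⟩
  rw [sub_eq_iff_eq_add] at hc
  rw [hc, ofCoords, ofCoords, C_0, zero_add]

/-- The normalized characteristic polynomials of the Gram matrices: `secular α n` has
constant coefficient `1`. -/
noncomputable def secular (α : ℝ) : ℕ → ℝ[X]
  | 0 => 1
  | 1 => 1 - C (α + 1)⁻¹ * X
  | n + 2 => secular α (n + 1) + C ((n + 2) / (n + 2 + α)) *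
      (secular α (n + 1) - secular α n - X * secular α (n + 1))

/-- The three-term recurrence for tridiagonal characteristic polynomials becomes that of `secular`
after division by the constant term. The constant term shows that `gram α n` has determinant `normSq
α n / normSq α 0`. -/
theorem gram_charpoly {α : ℝ} (hα : -1 < α) (n : ℕ) :
    (gram α n).charpoly = C ((-1) ^ n * (normSq α n / normSq α 0)) * secular α n := by
  induction n using Nat.twoStepInduction with
  | zero => simp [secular, charpoly, div_self (normSq_pos hα 0).ne']
  | one =>
    have h0 := (normSq_pos hα 0).ne'
    have h1 := normSq_succ hα 0
    have ha : α + 1 ≠ 0 := by linarith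
    have h2 : normSq α 1 / normSq α 0 = α + 1 := by
      rw [div_eq_iff h0]; simpa [add_comm] using h1
    have h3 : (gram α 1).charpoly = X - C (α + 1) := by
      rw [charpoly, det_unique, charmatrix_apply]
      simp [gram, tridiag, gramDiag, h2]
    have h4 : (C (α + 1) * C (α + 1)⁻¹ : ℝ[X]) = 1 := by rw [← C_mul, mul_inv_cancel₀ ha, C_1]
    rw [h3, h2, secular, pow_one, neg_one_mul, C_neg]
    linear_combination -X * h4
  | more n ih0 ih1 =>
    have h0 := (normSq_pos hα 0).ne'
    have hn := (normSq_pos hα n).ne'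
    have hn1 := (normSq_pos hα (n + 1)).ne'
    have hs := normSq_succ hα (n + 1)
    have ha : (n : ℝ) + 2 + α ≠ 0 := by
      have : (0 : ℝ) ≤ n := n.cast_nonneg
      linarith
    have hoff : gramOff α n ^ 2 = normSq α (n + 1) / normSq α n := by
      rw [gramOff, neg_sq, Real.sq_sqrt (div_nonneg (normSq_pos hα _).le (normSq_pos hα _).le)]
    have hdiag : gramDiag α (n + 1) = normSq α (n + 2) / normSq α (n + 1) + 1 := by
      rw [gramDiag, if_neg n.succ_ne_zero, add_div, div_self hn1]
    have hr : (n + 2) * normSq α (n + 2) = (n + 2 + α) * normSq α (n + 1) := by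
      push_cast at hs
      rw [show (n : ℝ) + 1 + 1 = n + 2 by ring] at hs
      exact hs
    simp only [gram] at ih0 ih1 ⊢
    rw [charpoly_tridiag_succ_succ, ih0, ih1, hoff, hdiag, secular]
    set u : ℝ := normSq α n / normSq α 0 with hu
    set v : ℝ := normSq α (n + 1) / normSq α n with hv
    set w : ℝ := normSq α (n + 2) / normSq α (n + 1) with hw
    have e1 : normSq α (n + 1) / normSq α 0 = v * u := by rw [hu, hv]; field_simp
    have e2 : normSq α (n + 2) / normSq α 0 = w * v * u := by rw [hu, hv, hw]; field_simp
    -- The factor in the recurrence of `secular` is the inverse norm ratio.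
    have e3 : w * ((n + 2) / (n + 2 + α)) = 1 := by
      rw [hw]; field_simp; linarith
    have e4 : (C w * C ((n + 2) / (n + 2 + α)) : ℝ[X]) = 1 := by rw [← C_mul, e3, C_1]
    rw [e1, e2]
    simp only [C_mul, C_add, C_1, C_pow, C_neg]
    linear_combination (-(-1) ^ n * C v * C u *
      (secular α (n + 1) - secular α n - X * secular α (n + 1))) * e4

theorem secular_coeff_zero (α : ℝ) (n : ℕ) : (secular α n).coeff 0 = 1 := by
  induction n using Nat.twoStepInduction with
  | zero => simp [secular]
  | one => simp [secular]
  | more n ih0 ih1 => simp [secular, ih0, ih1]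

/-- The squares of the singular values of differentiation on polynomials of degree at most `n` are
the reciprocals of the zeros of `secular α n`. -/
theorem exists_singular_values {α : ℝ} (hα : -1 < α) {n : ℕ} (hn : 0 < n) :
    ∃ μ : Fin n → ℝ, (∀ i, 0 < μ i) ∧ ∏ i, (1 - C (μ i) * X) = secular α n ∧
      (∀ M, (∀ i, μ i ≤ M) → ∀ p : ℝ[X], p.natDegree ≤ n →
        moment α (derivative p * derivative p) ≤ M * moment α (p * p)) ∧
      ∀ i, ∃ p : ℝ[X], p.natDegree ≤ n ∧ 0 < moment α (p * p) ∧
        moment α (derivative p * derivative p) = μ i * moment α (p * p) := by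
  have hA := isHermitian_gram α n
  -- Each eigenvalue is the squared norm of a polynomial, hence nonnegative; the nonzero constant
  -- term of the characteristic polynomial then makes it positive.
  have hnn : ∀ i, 0 ≤ hA.eigenvalues i := fun i => by
    obtain ⟨t, -, ht⟩ := hA.exists_eigenvector i
    have h := moment_mul_self_nonneg hα (ofCoords α 0 t)
    rw [moment_ofCoords_mul_self hα, ht] at h
    simpa using h
  have hc := hA.charpoly_eq
  rw [gram_charpoly hα] at hc
  obtain ⟨h0, hprod⟩ := eq_prod_one_sub_inv_mul_X Finset.univ hA.eigenvalues
    ((-1) ^ n * (normSq α n / normSq α 0)) (secular α n)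
    (mul_ne_zero (pow_ne_zero _ (by norm_num))
      (div_pos (normSq_pos hα n) (normSq_pos hα 0)).ne') (secular_coeff_zero α n) hc.symm
  have hpos : ∀ i, 0 < hA.eigenvalues i := fun i => (hnn i).lt_of_ne' (h0 i (Finset.mem_univ i))
  refine ⟨fun i => (hA.eigenvalues i)⁻¹, fun i => inv_pos.mpr (hpos i), hprod, ?_, ?_⟩
  · intro M hM p hp
    obtain ⟨c, t, rfl⟩ := exists_eq_ofCoords hα hn p hp
    have hM0 : 0 < M := (inv_pos.mpr (hpos ⟨0, hn⟩)).trans_le (hM _)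
    have h := hA.le_dotProduct_mulVec (c := M⁻¹)
      (fun i => inv_le_of_inv_le₀ (hpos i) (hM i)) t
    rw [moment_derivative_ofCoords_mul_self hα, moment_ofCoords_mul_self hα]
    have h1 := mul_le_mul_of_nonneg_left h hM0.le
    rw [mul_inv_cancel_left₀ hM0.ne'] at h1
    -- A constant component only enlarges `‖p‖`, so it can be discarded.
    have h2 : 0 ≤ M * (c ^ 2 * normSq α 0) :=
      mul_nonneg hM0.le (mul_nonneg (sq_nonneg c) (normSq_pos hα 0).le)
    linarith
  · intro i
    obtain ⟨t, ht1, ht⟩ := hA.exists_eigenvector i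
    have h := moment_ofCoords_mul_self hα 0 t
    rw [ht, zero_pow two_ne_zero, zero_mul, zero_add] at h
    refine ⟨ofCoords α 0 t, natDegree_ofCoords_le α 0 t, h ▸ hpos i, ?_⟩
    rw [h, moment_derivative_ofCoords_mul_self hα, ht1, inv_mul_cancel₀ (hpos i).ne']

/-- Two-sided bounds for the Markov constant from bounds for consecutive power sums. -/
theorem markovConst_bounds {α : ℝ} (hα : -1 < α) {n : ℕ} (hn : 0 < n) (μ : Fin n → ℝ)
    (hμ : ∀ i, 0 < μ i)
    (hup : ∀ M, (∀ i, μ i ≤ M) → ∀ p : ℝ[X], p.natDegree ≤ n →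
        moment α (derivative p * derivative p) ≤ M * moment α (p * p))
    (hlo : ∀ i, ∃ p : ℝ[X], p.natDegree ≤ n ∧ 0 < moment α (p * p) ∧
        moment α (derivative p * derivative p) = μ i * moment α (p * p))
    {k : ℕ} {l u : ℝ} (hu0 : 0 ≤ u) (hl : l * ∑ i, μ i ^ k ≤ ∑ i, μ i ^ (k + 1))
    (hu : ∑ i, μ i ^ (k + 1) ≤ u ^ (k + 1)) :
    BddAbove (markovQuotients n α) ∧ √l ≤ markovConst n α ∧ markovConst n α ≤ √u := by
  have hμu : ∀ i, μ i ≤ u := fun i => by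
    refine le_of_pow_le_pow_left₀ k.succ_ne_zero hu0 (le_trans ?_ hu)
    exact Finset.single_le_sum (f := fun i => μ i ^ (k + 1))
      (fun j _ => (pow_pos (hμ j) _).le) (Finset.mem_univ i)
  have hub : ∀ r ∈ markovQuotients n α, r ≤ √u := by
    rintro r ⟨p, -, hp, rfl⟩
    rw [wnorm_eval hα, wnorm_eval hα]
    refine div_le_of_le_mul₀ (Real.sqrt_nonneg _) (Real.sqrt_nonneg _) ?_
    rw [← Real.sqrt_mul hu0]
    exact Real.sqrt_le_sqrt (hup u hμu p hp)
  have hbdd : BddAbove (markovQuotients n α) := ⟨_, hub⟩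
  have hmem : ∀ i, √(μ i) ∈ markovQuotients n α := fun i => by
    obtain ⟨p, hp, hpos, he⟩ := hlo i
    refine ⟨p, fun h => ?_, hp, ?_⟩
    · rw [h] at hpos; simp at hpos
    · rw [wnorm_eval hα, wnorm_eval hα, he, Real.sqrt_mul (hμ i).le,
        mul_div_cancel_right₀ _ (Real.sqrt_pos.mpr hpos).ne']
  refine ⟨hbdd, ?_, csSup_le ⟨_, hmem ⟨0, hn⟩⟩ hub⟩
  -- If every `μ i` were below `l`, then `∑ μ i ^ (k + 1) < l * ∑ μ i ^ k`.
  obtain ⟨i, hi⟩ : ∃ i, l ≤ μ i := by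
    by_contra! h
    refine hl.not_gt ?_
    rw [Finset.mul_sum]
    refine Finset.sum_lt_sum_of_nonempty ⟨⟨0, hn⟩, Finset.mem_univ _⟩ fun i _ => ?_
    rw [pow_succ']
    exact mul_lt_mul_of_pos_right (h i) (pow_pos (hμ i) k)
  exact (Real.sqrt_le_sqrt hi).trans (le_csSup hbdd (hmem i))

end LaguerreMarkov

/-! ### Closed forms for the coefficients and power sums. -/

namespace LaguerreMarkov

open Polynomial

/-- Numerators of the coefficients of `secular α x`, where `a = α + 1`. -/
noncomputable def coeffNum (a x : ℝ) : ℕ → ℝ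
  | 0 => 1
  | 1 =>
    x * (x + 1) / 2
  | 2 =>
    x * (x + 1) * (x - 1) * ((3 * x + 2) * a + 3 * x + 10) / 24
  | 3 =>
    x * (x + 1) * (x - 1) * (x - 2) * ((((5 * x + 5) * x) * a + (20 * x + 76) * x + 12) * a +
    (15 * x + 119) * x + 228) / 240
  | 4 =>
    x * (x + 1) * (x - 1) * (x - 2) * (x - 3) * ((((((105 * x + 105) * x - 70) * x - 56) * a +
    ((945 * x + 3969) * x - 406) * x - 1400) * a + ((2415 * x + 19695) * x + 35510) * x -
    14984) * a + ((1575 * x + 21591) * x + 96006) * x + 137400) / 40320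
  | 5 =>
    x * (x + 1) * (x - 1) * (x - 2) * (x - 3) * (x - 4) * ((((((((21 * x + 14) * x - 49) * x -
    42) * x) * a + (((336 * x + 1456) * x - 1288) * x - 2024) * x - 240) * a + (((1806 * x +
    15460) * x + 22146) * x - 46612) * x - 8400) * a + (((3696 * x + 50512) * x + 208264) * x +
    169128) * x - 349200) * a + (((2205 * x + 45454) * x + 343471) * x + 1121406) * x + 1325520)
    / 80640
  | 6 =>
    x * (x + 1) * (x - 1) * (x - 2) * (x - 3) * (x - 4) * (x - 5) * (((((((((3465 * x * x -
    17325) * x - 12320) * x + 7700) * x + 5280) * a + ((((86625 * x + 360360) * x - 876645) * x -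
    1119800) * x + 184580) * x + 322080) * a + ((((796950 * x + 7001280) * x + 4733586) * x -
    50029056) * x - 2476584) * x + 6804864) * a + ((((3291750 * x + 46229040) * x +
    169997058) * x - 85888528) * x - 886221512) * x + 228467712) * a + ((((5852385 * x +
    118797120) * x + 836360091) * x + 2086943264) * x - 578212844) * x - 6449042976) * a +
    ((((3274425 * x + 93724200) * x + 1052171235) * x + 5767354440) * x + 15357765060) * x +
    15793475040) / 159667200
  | _ => 0

/-- Denominators of the coefficients of `secular α x`, where `a = α + 1`. -/
noncomputable def coeffDen (a : ℝ) : ℕ → ℝ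
  | 0 => 1
  | 1 => -a
  | 2 => a * (a + 1) * (a + 2)
  | 3 => -(a * (a + 1) * (a + 2) * (a + 3) * (a + 4))
  | 4 => a * (a + 1) * (a + 2) * (a + 3) * (a + 4) * (a + 5) * (a + 6)
  | 5 => -(a * (a + 1) * (a + 2) * (a + 3) * (a + 4) * (a + 5) * (a + 6) * (a + 7) * (a + 8))
  | 6 =>
    a * (a + 1) * (a + 2) * (a + 3) * (a + 4) * (a + 5) * (a + 6) * (a + 7) * (a + 8) * (a + 9) *
    (a + 10)
  | _ => 1

/-- Numerators of the power sums of the reciprocal zeros of `secular α x`, where `a = α + 1`. -/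
noncomputable def powerNum (a x : ℝ) : ℕ → ℝ
  | 1 =>
    x * (x + 1) / 2
  | 2 =>
    x * (x + 1) * (((2 * x + 1) * a + (3 * x + 1) * x + 5) * a + (3 * x + 3) * x) / 6
  | 3 =>
    x * (x + 1) * ((((((5 * x + 5) * x) * a + ((24 * x + 11) * x + 59) * x + 6) * a + (((20 * x +
    76) * x + 134) * x + 6) * x + 114) * a + (((80 * x + 100) * x + 170) * x + 150) * x) * a +
    ((60 * x + 120) * x + 60) * x * x) / 20
  | 4 =>
    x * (x + 1) * (((((((((((42 * x + 63) * x + 7) * x - 7) * a + (((420 * x + 336) * x +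
    1554) * x + 406) * x - 196) * a + ((((900 * x + 3930) * x + 7452) * x + 4308) * x +
    11022) * x - 2412) * a + (((((525 * x + 10095) * x + 21475) * x + 42449) * x + 26606) * x +
    24354) * x + 11206) * a + (((((6510 * x + 44250) * x + 87070) * x + 112136) * x + 107489) * x
    + 33561) * x + 47779) * a + (((((29400 * x + 104880) * x + 208720) * x + 201620) * x +
    183800) * x + 88360) * x + 34350) * a + (((((60270 * x + 155190) * x + 268380) * x +
    256830) * x + 157500) * x + 74130) * x) * a + ((((55755 * x + 142065) * x + 179865) * x +
    156555) * x + 63000) * x * x) * a + (((18900 * x + 56700) * x + 56700) * x +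
    18900) * x * x * x) / 210
  | 5 =>
    x * (x + 1) * ((((((((((((((42 * x + 84) * x + 21) * x - 21) * x) * a + ((((720 * x +
    498) * x + 3156) * x + 1464) * x - 834) * x - 90) * a + (((((2835 * x + 9405) * x +
    26547) * x + 6339) * x + 57396) * x - 16446) * x - 3420) * a + ((((((3920 * x + 47110) * x +
    103130) * x + 218632) * x + 205274) * x + 63946) * x + 285564) * x - 140580) * a +
    (((((((1764 * x + 74116) * x + 351134) * x + 816406) * x + 1003454) * x + 1360390) * x +
    442775) * x + 532815) * x + 97920) * a + (((((((36036 * x + 553504) * x + 1688666) * x +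
    3568294) * x + 4037150) * x + 3784258) * x + 2811422) * x + 397938) * x + 1229310) * a +
    (((((((282744 * x + 2158856) * x + 5630149) * x + 9378551) * x + 11065579) * x + 7854245) * x
    + 5960080) * x + 2649780) * x + 994140) * a + (((((((1079064 * x + 4961376) * x +
    12106584) * x + 16475256) * x + 17886204) * x + 13151880) * x + 6635160) * x +
    3118500) * x) * a + ((((((2080260 * x + 7226100) * x + 15250410) * x + 19810350) * x +
    16588530) * x + 11098710) * x + 4215960) * x * x) * a + (((((1884708 * x + 6480432) * x +
    10779048) * x + 12301632) * x + 8764308) * x + 2646000) * x * x * x) * a + ((((635040 * x +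
    2540160) * x + 3810240) * x + 2540160) * x + 635040) * x * x * x * x) / 252
  | 6 =>
    x * (x + 1) * (((((((((((((((((((((660 * x + 1650) * x + 660) * x - 660) * x - 110) * x +
    110) * a + (((((17325 * x + 17655) * x + 104775) * x + 66165) * x - 41910) * x - 15070) * x +
    8140) * a + ((((((107800 * x + 463925) * x + 1312795) * x + 895565) * x + 3974377) * x -
    1489972) * x - 645238) * x + 236368) * a + (((((((258720 * x + 3535840) * x + 9499490) * x +
    24722830) * x + 20858090) * x + 30703882) * x + 32694068) * x - 38861768) * x + 7071548) * a
    + ((((((((264600 * x + 9511320) * x + 57252300) * x + 148305360) * x + 261726900) * x +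
    347080530) * x + 141663264) * x + 413489796) * x - 180921306) * x - 61778844) * a +
    (((((((((97020 * x + 10423980) * x + 157342080) * x + 624602160) * x + 1538496855) * x +
    2164774365) * x + 2915841945) * x + 1477414923) * x + 1572719472) * x + 806257128) * x -
    1072216668) * a + (((((((((4000920 * x + 180155640) * x + 1570588740) * x + 5031126380) * x +
    10919762035) * x + 14588249285) * x + 15887164915) * x + 12271929587) * x + 3875780068) * x +
    7030379042) * x - 3855683672) * a + (((((((((71785560 * x + 1808986200) * x +
    10684258872) * x + 30279882808) * x + 56545990172) * x + 74600216668) * x + 67929452768) * x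
    + 57771901780) * x + 19122722180) * x + 17653563520) * x - 280993228) * a +
    (((((((((738784200 * x + 11780888280) * x + 52772166132) * x + 135469305748) * x +
    223533931922) * x + 280596449998) * x + 240766437278) * x + 179705388958) * x +
    90620635472) * x + 30169717288) * x + 25623223454) * a + (((((((((4836604080 * x +
    52635402960) * x + 195109201224) * x + 450352754376) * x + 683832992934) * x +
    785131804146) * x + 670794282546) * x + 431374989966) * x + 253959944934) * x +
    78076561406) * x + 57402895168) * a + (((((((((21095298840 * x + 166613629560) * x +
    543358741548) * x + 1118358592652) * x + 1598469203338) * x + 1669274827862) * x +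
    1385415008182) * x + 836587083974) * x + 445734389536) * x + 167737689684) * x +
    50144242584) * a + (((((((((62354578440 * x + 380551806600) * x + 1126961175144) * x +
    2083541289256) * x + 2785408588844) * x + 2699863357156) * x + 2057575995356) * x +
    1198326934924) * x + 521213036456) * x + 175575403584) * x + 15793475040) * a +
    (((((((((124477445400 * x + 630431321520) * x + 1702897086660) * x + 2885756393520) * x +
    3525714658620) * x + 3189820801860) * x + 2147339289480) * x + 1110081999180) * x +
    382978725360) * x + 67316689440) * x) * a + ((((((((163926724500 * x + 746089912260) * x +
    1821003944760) * x + 2863320573960) * x + 3139087685580) * x + 2543840602380) * x +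
    1476198690120) * x + 575431524360) * x + 128465568000) * x * x) * a + (((((((135324105840 * x
    + 599191916400) * x + 1320085166400) * x + 1889283765600) * x + 1835764484400) * x +
    1226370000240) * x + 550038535200) * x + 126366609600) * x * x * x) * a +
    ((((((63023637600 * x + 289970604000) * x + 592515000000) * x + 730826712000) * x +
    591741612000) * x + 289351893600) * x + 62868960000) * x * x * x * x) * a +
    (((((12573792000 * x + 62868960000) * x + 125737920000) * x + 125737920000) * x +
    62868960000) * x + 12573792000) * x * x * x * x * x) / 4620
  | _ => 0

/-- Denominators of the power sums of the reciprocal zeros of `secular α x`, where `a = α + 1`. -/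
noncomputable def powerDen (a : ℝ) : ℕ → ℝ
  | 1 => a
  | 2 => a ^ 2 * (a + 1) * (a + 2)
  | 3 => a ^ 3 * (a + 1) * (a + 2) * (a + 3) * (a + 4)
  | 4 => a ^ 4 * (a + 1) ^ 2 * (a + 2) ^ 2 * (a + 3) * (a + 4) * (a + 5) * (a + 6)
  | 5 => a ^ 5 * (a + 1) ^ 2 * (a + 2) ^ 2 * (a + 3) * (a + 4) * (a + 5) * (a + 6) * (a + 7) *
      (a + 8)
  | 6 => a ^ 6 * (a + 1) ^ 3 * (a + 2) ^ 3 * (a + 3) ^ 2 * (a + 4) ^ 2 * (a + 5) * (a + 6) *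
      (a + 7) * (a + 8) * (a + 9) * (a + 10)
  | _ => 1

/-- Comparing coefficients of `X ^ (k + 1)` in the recurrence of `secular` gives a second-order
recurrence in `n` with two initial values. A guessed numerator `N'` is thus certified by polynomial
identities alone. -/
theorem secular_coeff_succ {α : ℝ} (hα : -1 < α) {k : ℕ} {N N' : ℝ → ℝ} {d r : ℝ} (hd : d ≠ 0)
    (hr : r ≠ 0) (hN : ∀ n : ℕ, (secular α n).coeff k = N n / d) (h0 : N' 0 = 0)
    (h1 : (α + 1) * N' 1 = r * N 0)
    (hrec : ∀ x, (x + 1 + (α + 1)) * (N' (x + 2) - N' (x + 1)) =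
      (x + 2) * (N' (x + 1) - N' x + r * N (x + 1))) (n : ℕ) :
    (secular α n).coeff (k + 1) = N' n / -(d * r) := by
  have ha : α + 1 ≠ 0 := by linarith
  induction n using Nat.twoStepInduction with
  | zero => simp [secular, coeff_one, h0]
  | one =>
    have hk : (1 : ℝ[X]).coeff k = N 0 / d := by simpa [secular] using hN 0
    rw [secular, coeff_sub, coeff_C_mul, coeff_X, Nat.cast_one]
    rw [coeff_one] at hk ⊢
    rw [if_neg k.succ_ne_zero]
    by_cases h : k = 0
    · rw [if_pos h] at hk
      rw [if_pos (by omega)]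
      field_simp at hk ⊢
      linear_combination h1 - r * hk
    · rw [if_neg h] at hk
      rw [if_neg (by omega)]
      field_simp at hk ⊢
      have h2 : (α + 1) * N' 1 = 0 := by rw [h1, ← hk]; ring
      simp [(mul_eq_zero.mp h2).resolve_left ha]
  | more n ih0 ih1 =>
    have hn2 : (n : ℝ) + 2 + α ≠ 0 := by
      have : (0 : ℝ) ≤ n := n.cast_nonneg
      linarith
    have h := hrec n
    rw [secular, coeff_add, coeff_C_mul, coeff_sub, coeff_sub, coeff_X_mul, hN, ih0, ih1]
    push_cast
    field_simp
    linear_combination h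

theorem secular_coeff {α : ℝ} (hα : -1 < α) {k : ℕ} (hk : k ≤ 6) (n : ℕ) :
    (secular α n).coeff k = coeffNum (α + 1) n k / coeffDen (α + 1) k := by
  obtain ⟨a, rfl⟩ : ∃ a, α = a - 1 := ⟨α + 1, by ring⟩
  have ha : 0 < a := by linarith
  rw [sub_add_cancel]
  have h0 : ∀ n : ℕ, (secular (a - 1) n).coeff 0 = coeffNum a n 0 / coeffDen a 0 := fun n => by
    simp [secular_coeff_zero, coeffNum, coeffDen]
  have h1 : ∀ n : ℕ, (secular (a - 1) n).coeff 1 = coeffNum a n 1 / coeffDen a 1 := by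
    rw [show coeffDen a 1 = -(coeffDen a 0 * (a)) by simp only [coeffDen]; ring]
    refine secular_coeff_succ hα (N := fun x => coeffNum a x 0) (N' := fun x => coeffNum a x 1)
      (by simp only [coeffDen]; positivity)
      (by positivity) h0 ?_ ?_ fun x => ?_ <;> simp only [coeffNum] <;> ring
  have h2 : ∀ n : ℕ, (secular (a - 1) n).coeff 2 = coeffNum a n 2 / coeffDen a 2 := by
    rw [show coeffDen a 2 = -(coeffDen a 1 * ((a + 1) * (a + 2))) by simp only [coeffDen]; ring]
    refine secular_coeff_succ hα (N := fun x => coeffNum a x 1) (N' := fun x => coeffNum a x 2)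
      (by simp only [coeffDen]; exact neg_ne_zero.mpr (by positivity))
      (by positivity) h1 ?_ ?_ fun x => ?_ <;> simp only [coeffNum] <;> ring
  have h3 : ∀ n : ℕ, (secular (a - 1) n).coeff 3 = coeffNum a n 3 / coeffDen a 3 := by
    rw [show coeffDen a 3 = -(coeffDen a 2 * ((a + 3) * (a + 4))) by simp only [coeffDen]; ring]
    refine secular_coeff_succ hα (N := fun x => coeffNum a x 2) (N' := fun x => coeffNum a x 3)
      (by simp only [coeffDen]; positivity)
      (by positivity) h2 ?_ ?_ fun x => ?_ <;> simp only [coeffNum] <;> ring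
  have h4 : ∀ n : ℕ, (secular (a - 1) n).coeff 4 = coeffNum a n 4 / coeffDen a 4 := by
    rw [show coeffDen a 4 = -(coeffDen a 3 * ((a + 5) * (a + 6))) by simp only [coeffDen]; ring]
    refine secular_coeff_succ hα (N := fun x => coeffNum a x 3) (N' := fun x => coeffNum a x 4)
      (by simp only [coeffDen]; exact neg_ne_zero.mpr (by positivity))
      (by positivity) h3 ?_ ?_ fun x => ?_ <;> simp only [coeffNum] <;> ring
  have h5 : ∀ n : ℕ, (secular (a - 1) n).coeff 5 = coeffNum a n 5 / coeffDen a 5 := by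
    rw [show coeffDen a 5 = -(coeffDen a 4 * ((a + 7) * (a + 8))) by simp only [coeffDen]; ring]
    refine secular_coeff_succ hα (N := fun x => coeffNum a x 4) (N' := fun x => coeffNum a x 5)
      (by simp only [coeffDen]; positivity)
      (by positivity) h4 ?_ ?_ fun x => ?_ <;> simp only [coeffNum] <;> ring
  have h6 : ∀ n : ℕ, (secular (a - 1) n).coeff 6 = coeffNum a n 6 / coeffDen a 6 := by
    rw [show coeffDen a 6 = -(coeffDen a 5 * ((a + 9) * (a + 10))) by simp only [coeffDen]; ring]
    refine secular_coeff_succ hα (N := fun x => coeffNum a x 5) (N' := fun x => coeffNum a x 6)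
      (by simp only [coeffDen]; exact neg_ne_zero.mpr (by positivity))
      (by positivity) h5 ?_ ?_ fun x => ?_ <;> simp only [coeffNum] <;> ring
  interval_cases k
  exacts [h0 n, h1 n, h2 n, h3 n, h4 n, h5 n, h6 n]

/-- This and the next five identities are Newton's identities with denominators cleared: up to sign,
the cofactors are the quotients of `powerDen a k` by `coeffDen a j * powerDen a (k - j)`. -/
theorem powerNum_newton_1 (a x : ℝ) :
    powerNum a x 1 =
      coeffNum a x 1 := by
  simp only [powerNum, coeffNum]

theorem powerNum_newton_2 (a x : ℝ) :
    powerNum a x 2 =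
      coeffNum a x 1 * powerNum a x 1 * ((a + 1) * (a + 2)) - 2 * coeffNum a x 2 * (a) := by
  simp only [powerNum, coeffNum]
  ring

theorem powerNum_newton_3 (a x : ℝ) :
    powerNum a x 3 =
      coeffNum a x 1 * powerNum a x 2 * ((a + 3) * (a + 4)) - coeffNum a x 2 * powerNum a x 1 *
      (a * (a + 3) * (a + 4)) + 3 * coeffNum a x 3 * (a ^ 2) := by
  simp only [powerNum, coeffNum]
  ring

theorem powerNum_newton_4 (a x : ℝ) :
    powerNum a x 4 =
      coeffNum a x 1 * powerNum a x 3 * ((a + 1) * (a + 2) * (a + 5) * (a + 6)) - coeffNum a x 2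
      * powerNum a x 2 * (a * (a + 3) * (a + 4) * (a + 5) * (a + 6)) + coeffNum a x 3 * powerNum
      a x 1 * (a ^ 2 * (a + 1) * (a + 2) * (a + 5) * (a + 6)) - 4 * coeffNum a x 4 * (a ^ 3 * (a
      + 1) * (a + 2)) := by
  simp only [powerNum, coeffNum]
  ring

theorem powerNum_newton_5 (a x : ℝ) :
    powerNum a x 5 =
      coeffNum a x 1 * powerNum a x 4 * ((a + 7) * (a + 8)) - coeffNum a x 2 * powerNum a x 3 *
      (a * (a + 5) * (a + 6) * (a + 7) * (a + 8)) + coeffNum a x 3 * powerNum a x 2 * (a ^ 2 * (a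
      + 5) * (a + 6) * (a + 7) * (a + 8)) - coeffNum a x 4 * powerNum a x 1 * (a ^ 3 * (a + 1) *
      (a + 2) * (a + 7) * (a + 8)) + 5 * coeffNum a x 5 * (a ^ 4 * (a + 1) * (a + 2)) := by
  simp only [powerNum, coeffNum]
  ring

theorem powerNum_newton_6 (a x : ℝ) :
    powerNum a x 6 =
      coeffNum a x 1 * powerNum a x 5 * ((a + 1) * (a + 2) * (a + 3) * (a + 4) * (a + 9) * (a +
      10)) - coeffNum a x 2 * powerNum a x 4 * (a * (a + 3) * (a + 4) * (a + 7) * (a + 8) * (a +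
      9) * (a + 10)) + coeffNum a x 3 * powerNum a x 3 * (a ^ 2 * (a + 1) * (a + 2) * (a + 5) *
      (a + 6) * (a + 7) * (a + 8) * (a + 9) * (a + 10)) - coeffNum a x 4 * powerNum a x 2 *
      (a ^ 3 * (a + 1) * (a + 2) * (a + 3) * (a + 4) * (a + 7) * (a + 8) * (a + 9) * (a + 10)) +
      coeffNum a x 5 * powerNum a x 1 * (a ^ 4 * (a + 1) ^ 2 * (a + 2) ^ 2 * (a + 3) * (a + 4) *
      (a + 9) * (a + 10)) - 6 * coeffNum a x 6 * (a ^ 5 * (a + 1) ^ 2 * (a + 2) ^ 2 * (a + 3) *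
      (a + 4)) := by
  simp only [powerNum, coeffNum]
  ring

/-- The power sums of the reciprocal zeros of `secular α n`. -/
theorem sum_pow_eq {α : ℝ} (hα : -1 < α) {n : ℕ} (μ : Fin n → ℝ)
    (hμ : ∏ i, (1 - C (μ i) * X) = secular α n) {k : ℕ} (hk1 : 1 ≤ k) (hk6 : k ≤ 6) :
    ∑ i, μ i ^ k = powerNum (α + 1) n k / powerDen (α + 1) k := by
  have ha : 0 < α + 1 := by linarith
  have hN (m : ℕ) : (m + 1) * (secular α n).coeff (m + 1) = -∑ j ∈ Finset.range (m + 1),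
      (secular α n).coeff j * ∑ i, μ i ^ (m + 1 - j) := by
    rw [← hμ]; exact newton_coeff_prod_one_sub Finset.univ μ m
  have c0 := secular_coeff hα (show 0 ≤ 6 by norm_num) n
  have c1 := secular_coeff hα (show 1 ≤ 6 by norm_num) n
  have c2 := secular_coeff hα (show 2 ≤ 6 by norm_num) n
  have c3 := secular_coeff hα (show 3 ≤ 6 by norm_num) n
  have c4 := secular_coeff hα (show 4 ≤ 6 by norm_num) n
  have c5 := secular_coeff hα (show 5 ≤ 6 by norm_num) n
  have c6 := secular_coeff hα (show 6 ≤ 6 by norm_num) n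
  generalize α + 1 = a at *
  generalize (n : ℝ) = x at *
  have h1 : ∑ i, μ i ^ 1 = powerNum a x 1 / powerDen a 1 := by
    have h := hN 0
    simp only [Finset.sum_range_succ, Finset.sum_range_zero, Nat.reduceAdd, Nat.reduceSub,
      c0, c1] at h
    rw [show coeffNum a x 0 / coeffDen a 0 = 1 by simp [coeffNum, coeffDen]] at h
    rw [powerNum_newton_1]
    simp only [coeffDen, powerDen] at h ⊢
    -- The explicit polynomials have done their work in the preceding identity. From here on they
    -- stay opaque, so only the factors in `a` are manipulated; the same holds for the later power
    -- sums.
    generalize powerNum a x = P at *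
    generalize coeffNum a x = N at *
    push_cast at h
    rw [eq_div_iff (by positivity)]
    simp only [pow_one] at h ⊢
    field_simp at h
    linear_combination h
  have h2 : ∑ i, μ i ^ 2 = powerNum a x 2 / powerDen a 2 := by
    have h := hN 1
    simp only [Finset.sum_range_succ, Finset.sum_range_zero, Nat.reduceAdd, Nat.reduceSub,
      c0, c1, c2, h1] at h
    rw [show coeffNum a x 0 / coeffDen a 0 = 1 by simp [coeffNum, coeffDen]] at h
    rw [powerNum_newton_2]
    simp only [coeffDen, powerDen] at h ⊢
    generalize powerNum a x = P at *
    generalize coeffNum a x = N at *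
    push_cast at h
    rw [eq_div_iff (by positivity)]
    field_simp at h
    linear_combination h
  have h3 : ∑ i, μ i ^ 3 = powerNum a x 3 / powerDen a 3 := by
    have h := hN 2
    simp only [Finset.sum_range_succ, Finset.sum_range_zero, Nat.reduceAdd, Nat.reduceSub,
      c0, c1, c2, c3, h1, h2] at h
    rw [show coeffNum a x 0 / coeffDen a 0 = 1 by simp [coeffNum, coeffDen]] at h
    rw [powerNum_newton_3]
    simp only [coeffDen, powerDen] at h ⊢
    generalize powerNum a x = P at *
    generalize coeffNum a x = N at *
    push_cast at h
    rw [eq_div_iff (by positivity)]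
    field_simp at h
    linear_combination h
  have h4 : ∑ i, μ i ^ 4 = powerNum a x 4 / powerDen a 4 := by
    have h := hN 3
    simp only [Finset.sum_range_succ, Finset.sum_range_zero, Nat.reduceAdd, Nat.reduceSub,
      c0, c1, c2, c3, c4, h1, h2, h3] at h
    rw [show coeffNum a x 0 / coeffDen a 0 = 1 by simp [coeffNum, coeffDen]] at h
    rw [powerNum_newton_4]
    simp only [coeffDen, powerDen] at h ⊢
    generalize powerNum a x = P at *
    generalize coeffNum a x = N at *
    push_cast at h
    rw [eq_div_iff (by positivity)]
    field_simp at h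
    linear_combination h
  have h5 : ∑ i, μ i ^ 5 = powerNum a x 5 / powerDen a 5 := by
    have h := hN 4
    simp only [Finset.sum_range_succ, Finset.sum_range_zero, Nat.reduceAdd, Nat.reduceSub,
      c0, c1, c2, c3, c4, c5, h1, h2, h3, h4] at h
    rw [show coeffNum a x 0 / coeffDen a 0 = 1 by simp [coeffNum, coeffDen]] at h
    rw [powerNum_newton_5]
    simp only [coeffDen, powerDen] at h ⊢
    generalize powerNum a x = P at *
    generalize coeffNum a x = N at *
    push_cast at h
    rw [eq_div_iff (by positivity)]
    field_simp at h
    linear_combination h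
  have h6 : ∑ i, μ i ^ 6 = powerNum a x 6 / powerDen a 6 := by
    have h := hN 5
    simp only [Finset.sum_range_succ, Finset.sum_range_zero, Nat.reduceAdd, Nat.reduceSub,
      c0, c1, c2, c3, c4, c5, c6, h1, h2, h3, h4, h5] at h
    rw [show coeffNum a x 0 / coeffDen a 0 = 1 by simp [coeffNum, coeffDen]] at h
    rw [powerNum_newton_6]
    simp only [coeffDen, powerDen] at h ⊢
    generalize powerNum a x = P at *
    generalize coeffNum a x = N at *
    push_cast at h
    rw [eq_div_iff (by positivity)]
    field_simp at h
    linear_combination h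
  interval_cases k
  exacts [h1, h2, h3, h4, h5, h6]

end LaguerreMarkov

/-! ### Polynomial inequalities behind the bounds. -/

namespace LaguerreMarkov

/-- In all four upper bounds the two sides have the same leading coefficient in `x`. The shifts
`2/5`, `3/7`, `4/9`, `5/11` also match the highest power of `a` in the coefficient of `x ^ (2 * k -
1)`. With `x = y + 1`, the difference has only nonnegative coefficients in `a` and `y`. -/
theorem powerNum_le_3 {a x : ℝ} (ha : 0 < a) (hx : 1 ≤ x) :
    powerNum a x 3 ≤ (x + 1) ^ 3 * (x + 2 * a / 5) ^ 3 * ((a + 1) * (a + 3)) := by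
  obtain ⟨y, rfl⟩ : ∃ y, x = y + 1 := ⟨x - 1, by ring⟩
  have hy : 0 ≤ y := by linarith
  rw [← sub_nonneg]
  simp only [powerNum]
  ring_nf
  positivity

/-- In all four lower bounds the leading coefficients in `x` again agree. The shifts `3/8`, `8/25`,
`25/84`, `2/7` are those for which the top power of `a` has matching leading terms in `x` too. -/
theorem le_powerNum_3 {a x : ℝ} (ha : 0 < a) (hx : 1 ≤ x) :
    2 * x * (x + 3 * a / 8) * (a + 3) * powerNum a x 2 ≤ powerNum a x 3 := by
  obtain ⟨y, rfl⟩ : ∃ y, x = y + 1 := ⟨x - 1, by ring⟩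
  have hy : 0 ≤ y := by linarith
  -- The difference itself has a negative coefficient, `-1/30` at `a ^ 2 * y ^ 5`; multiplication by
  -- `a + 1` lets the neighbouring powers of `a` absorb it.
  rw [← sub_nonneg, ← mul_nonneg_iff_of_pos_left (show 0 < a + 1 by linarith)]
  simp only [powerNum]
  ring_nf
  positivity

theorem powerNum_le_4 {a x : ℝ} (ha : 0 < a) (hx : 1 ≤ x) :
    2 * powerNum a x 4 ≤ (5 * a + 12) * (x + 1) ^ 4 * (x + 3 * a / 7) ^ 4 *
      ((a + 1) ^ 2 * (a + 3) * (a + 5)) := by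
  obtain ⟨y, rfl⟩ : ∃ y, x = y + 1 := ⟨x - 1, by ring⟩
  have hy : 0 ≤ y := by linarith
  rw [← sub_nonneg]
  simp only [powerNum]
  ring_nf
  positivity

theorem le_powerNum_4 {a x : ℝ} (ha : 0 < a) (hx : 1 ≤ x) :
    (5 * a + 12) * x * (x + 8 * a / 25) * ((a + 1) * (a + 5)) * powerNum a x 3 ≤
      2 * powerNum a x 4 := by
  obtain ⟨y, rfl⟩ : ∃ y, x = y + 1 := ⟨x - 1, by ring⟩
  have hy : 0 ≤ y := by linarith
  rw [← sub_nonneg]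
  simp only [powerNum]
  ring_nf
  positivity

theorem powerNum_le_5 {a x : ℝ} (ha : 0 < a) (hx : 1 ≤ x) :
    powerNum a x 5 ≤ (7 * a + 24) * (x + 1) ^ 5 * (x + 4 * a / 9) ^ 5 *
      ((a + 1) ^ 2 * (a + 3) * (a + 5) * (a + 7)) := by
  obtain ⟨y, rfl⟩ : ∃ y, x = y + 1 := ⟨x - 1, by ring⟩
  have hy : 0 ≤ y := by linarith
  rw [← sub_nonneg]
  simp only [powerNum]
  ring_nf
  positivity

theorem le_powerNum_5 {a x : ℝ} (ha : 0 < a) (hx : 1 ≤ x) :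
    2 * (7 * a + 24) * x * (x + 25 * a / 84) * (a + 7) * powerNum a x 4 ≤
      (5 * a + 12) * powerNum a x 5 := by
  obtain ⟨y, rfl⟩ : ∃ y, x = y + 1 := ⟨x - 1, by ring⟩
  have hy : 0 ≤ y := by linarith
  rw [← sub_nonneg]
  simp only [powerNum]
  ring_nf
  positivity

set_option maxRecDepth 10000 in
theorem powerNum_le_6 {a x : ℝ} (ha : 0 < a) (hx : 1 ≤ x) :
    powerNum a x 6 ≤
      (21 * a ^ 3 + 236 * a ^ 2 + 856 * a + 960) * (x + 1) ^ 6 * (x + 5 * a / 11) ^ 6 *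
      ((a + 1) ^ 3 * (a + 3) ^ 2 * (a + 5) * (a + 7) * (a + 9)) := by
  obtain ⟨y, rfl⟩ : ∃ y, x = y + 1 := ⟨x - 1, by ring⟩
  have hy : 0 ≤ y := by linarith
  rw [← sub_nonneg]
  simp only [powerNum]
  ring_nf
  positivity

set_option maxRecDepth 10000 in
theorem le_powerNum_6 {a x : ℝ} (ha : 0 < a) (hx : 1 ≤ x) :
    (21 * a ^ 3 + 236 * a ^ 2 + 856 * a + 960) * x * (x + 2 * a / 7) *
      ((a + 1) * (a + 3) * (a + 9)) * powerNum a x 5 ≤ (7 * a + 24) * powerNum a x 6 := by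
  obtain ⟨y, rfl⟩ : ∃ y, x = y + 1 := ⟨x - 1, by ring⟩
  have hy : 0 ≤ y := by linarith
  rw [← sub_nonneg]
  simp only [powerNum]
  ring_nf
  positivity

end LaguerreMarkov

/-! ### Comparison with the stated bounds. -/

namespace LaguerreMarkov

theorem powerDen_pos {a : ℝ} (ha : 0 < a) (k : ℕ) : 0 < powerDen a k := by
  unfold powerDen
  split <;> positivity

/-- Raising the upper bound to the power `k` turns each fractional exponent `r` into the integer
`m`, leaving a rational function. -/
theorem rpow_div_pow {x : ℝ} (hx : 0 ≤ x) {r : ℝ} {k m : ℕ} (h : r * k = m) :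
    (x ^ r) ^ k = x ^ m := by
  rw [← Real.rpow_natCast, ← Real.rpow_mul hx, h, Real.rpow_natCast]

theorem lowerSq_mul_le {α x : ℝ} (hα : -1 < α) (hx : 1 ≤ x) {k : ℕ} (hk3 : 3 ≤ k) (hk6 : k ≤ 6) :
    lowerSq k x α * (powerNum (α + 1) x (k - 1) / powerDen (α + 1) (k - 1)) ≤
      powerNum (α + 1) x k / powerDen (α + 1) k := by
  obtain ⟨a, rfl⟩ : ∃ a, α = a - 1 := ⟨α + 1, by ring⟩
  have ha : 0 < a := by linarith
  rw [sub_add_cancel]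
  rw [le_div_iff₀ (powerDen_pos ha k)]
  interval_cases k
  · refine le_trans (le_of_eq ?_) (le_powerNum_3 ha hx)
    simp only [lowerSq, powerDen, Nat.reduceSub]
    generalize powerNum a x = P
    rw [sub_add_cancel, show a - 1 + 5 = a + 4 by ring]
    field_simp
  · have h := le_powerNum_4 ha hx
    rw [← div_le_iff₀' two_pos] at h
    refine le_trans (le_of_eq ?_) h
    simp only [lowerSq, powerDen, Nat.reduceSub]
    generalize powerNum a x = P
    rw [sub_add_cancel, show 5 * (a - 1) + 17 = 5 * a + 12 by ring,
      show a - 1 + 3 = a + 2 by ring, show a - 1 + 7 = a + 6 by ring]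
    field_simp
  · have h := le_powerNum_5 ha hx
    rw [← div_le_iff₀' (by positivity)] at h
    refine le_trans (le_of_eq ?_) h
    simp only [lowerSq, powerDen, Nat.reduceSub]
    generalize powerNum a x = P
    rw [sub_add_cancel, show 5 * (a - 1) + 17 = 5 * a + 12 by ring,
      show 7 * (a - 1) + 31 = 7 * a + 24 by ring, show a - 1 + 9 = a + 8 by ring]
    field_simp
  · have h := le_powerNum_6 ha hx
    rw [← div_le_iff₀' (by positivity)] at h
    refine le_trans (le_of_eq ?_) h
    simp only [lowerSq, powerDen, Nat.reduceSub]
    generalize powerNum a x = P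
    rw [sub_add_cancel, show 21 * (a - 1) ^ 3 + 299 * (a - 1) ^ 2 + 1391 * (a - 1) + 2073 =
        21 * a ^ 3 + 236 * a ^ 2 + 856 * a + 960 by ring,
      show 7 * (a - 1) + 31 = 7 * a + 24 by ring, show a - 1 + 3 = a + 2 by ring,
      show a - 1 + 5 = a + 4 by ring, show a - 1 + 11 = a + 10 by ring]
    field_simp

theorem upperSq_nonneg {α x : ℝ} (hα : -1 < α) (hx : 1 ≤ x) (k : ℕ) : 0 ≤ upperSq k x α := by
  obtain ⟨a, rfl⟩ : ∃ a, α = a - 1 := ⟨α + 1, by ring⟩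
  have ha : 0 < a := by linarith
  -- Rewriting in terms of `a` makes every summand visibly positive.
  have h (c : ℝ) : a - 1 + c = a + (c - 1) := by ring
  have h4 : 5 * (a - 1) + 17 = 5 * a + 12 := by ring
  have h5 : 7 * (a - 1) + 31 = 7 * a + 24 := by ring
  have h6 : 21 * (a - 1) ^ 3 + 299 * (a - 1) ^ 2 + 1391 * (a - 1) + 2073 =
    21 * a ^ 3 + 236 * a ^ 2 + 856 * a + 960 := by ring
  unfold upperSq
  split <;> (try simp only [h4, h5, h6, h]) <;> norm_num1 <;> positivity

theorem le_upperSq_pow {α x : ℝ} (hα : -1 < α) (hx : 1 ≤ x) {k : ℕ} (hk3 : 3 ≤ k) (hk6 : k ≤ 6) :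
    powerNum (α + 1) x k / powerDen (α + 1) k ≤ upperSq k x α ^ k := by
  obtain ⟨a, rfl⟩ : ∃ a, α = a - 1 := ⟨α + 1, by ring⟩
  have ha : 0 < a := by linarith
  have h3 : a - 1 + 3 = a + 2 := by ring
  have h5 : a - 1 + 5 = a + 4 := by ring
  have h7 : a - 1 + 7 = a + 6 := by ring
  have h9 : a - 1 + 9 = a + 8 := by ring
  have h11 : a - 1 + 11 = a + 10 := by ring
  have e4 : 5 * (a - 1) + 17 = 5 * a + 12 := by ring
  have e5 : 7 * (a - 1) + 31 = 7 * a + 24 := by ring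
  have e6 : 21 * (a - 1) ^ 3 + 299 * (a - 1) ^ 2 + 1391 * (a - 1) + 2073 =
    21 * a ^ 3 + 236 * a ^ 2 + 856 * a + 960 := by ring
  rw [sub_add_cancel, div_le_iff₀ (powerDen_pos ha k)]
  interval_cases k
  · refine (powerNum_le_3 ha hx).trans (le_of_eq ?_)
    simp only [upperSq, powerDen, sub_add_cancel, h3, h5]
    rw [div_pow, mul_pow, mul_pow,
      rpow_div_pow (m := 1) (by positivity : 0 ≤ (a + 2) * (a + 4)) (by norm_num)]
    field_simp
  · have h := powerNum_le_4 ha hx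
    rw [← le_div_iff₀' two_pos] at h
    refine h.trans (le_of_eq ?_)
    simp only [upperSq, powerDen, sub_add_cancel, h3, h5, h7, e4]
    rw [div_pow, mul_pow, mul_pow, mul_pow, mul_pow,
      rpow_div_pow (m := 1) (by positivity : 0 ≤ 5 * a + 12) (by norm_num),
      rpow_div_pow (m := 2) (by positivity : 0 ≤ a + 2) (by norm_num),
      rpow_div_pow (m := 1) (by positivity : 0 ≤ 2 * (a + 4) * (a + 6)) (by norm_num)]
    field_simp
  · refine (powerNum_le_5 ha hx).trans (le_of_eq ?_)
    simp only [upperSq, powerDen, sub_add_cancel, h3, h5, h7, h9, e5]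
    rw [div_pow, mul_pow, mul_pow, mul_pow, mul_pow,
      rpow_div_pow (m := 1) (by positivity : 0 ≤ 7 * a + 24) (by norm_num),
      rpow_div_pow (m := 2) (by positivity : 0 ≤ a + 2) (by norm_num),
      rpow_div_pow (m := 1) (by positivity : 0 ≤ (a + 4) * (a + 6) * (a + 8)) (by norm_num)]
    field_simp
  · refine (powerNum_le_6 ha hx).trans (le_of_eq ?_)
    simp only [upperSq, powerDen, sub_add_cancel, h3, h5, h7, h9, h11, e6]
    rw [div_pow, mul_pow, mul_pow, mul_pow, mul_pow, mul_pow,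
      rpow_div_pow (m := 1)
        (by positivity : 0 ≤ 21 * a ^ 3 + 236 * a ^ 2 + 856 * a + 960) (by norm_num),
      rpow_div_pow (m := 3) (by positivity : 0 ≤ a + 2) (by norm_num),
      rpow_div_pow (m := 2) (by positivity : 0 ≤ a + 4) (by norm_num),
      rpow_div_pow (m := 1) (by positivity : 0 ≤ (a + 6) * (a + 8) * (a + 10)) (by norm_num)]
    field_simp

end LaguerreMarkov

theorem theorem1p1 (k : ℕ) (hk3 : 3 ≤ k) (hk6 : k ≤ 6) (n : ℕ) (hn : k ≤ n)
    (α : ℝ) (hα : -1 < α) :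
    BddAbove (LaguerreMarkov.markovQuotients n α) ∧
    Real.sqrt (LaguerreMarkov.lowerSq k n α) ≤ LaguerreMarkov.markovConst n α ∧
    LaguerreMarkov.markovConst n α ≤ Real.sqrt (LaguerreMarkov.upperSq k n α) := by
  have hn0 : 0 < n := by omega
  have hx : (1 : ℝ) ≤ n := Nat.one_le_cast.mpr hn0
  obtain ⟨μ, hμ, hprod, hup, hlo⟩ := LaguerreMarkov.exists_singular_values hα hn0
  have hk : k - 1 + 1 = k := by omega
  -- The lower bound compares the power sums of orders `k - 1` and `k`, hence the shifted index.
  refine LaguerreMarkov.markovConst_bounds hα hn0 μ hμ hup hlo (k := k - 1)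
    (LaguerreMarkov.upperSq_nonneg hα hx k) ?_ ?_
  · rw [hk, LaguerreMarkov.sum_pow_eq hα μ hprod (by omega) (by omega),
      LaguerreMarkov.sum_pow_eq hα μ hprod (by omega) hk6]
    exact LaguerreMarkov.lowerSq_mul_le hα hx hk3 hk6
  · rw [hk, LaguerreMarkov.sum_pow_eq hα μ hprod (by omega) hk6]
    exact LaguerreMarkov.le_upperSq_pow hα hx hk3 hk6
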